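/- Let $a<b<c$ be real numbers, $K=\{a\}\cup[b,c]$, and let $F(x)=\sum_{i=0}^n F_i x^i$ be a $p\times p$ matrix polynomial whose coefficients $F_i$ are real symmetric matrices, with $F_n\neq 0$ (so $\deg F=n$). Assume that the matrix $F(x)$ is positive semidefinite for every $x\in K$. A symmetric square is a matrix polynomial of the form $H(x)^TH(x)$ with $H$ a $p\times p$ real matrix polynomial. (1) If $n$ is even, then there are $p\times p$ real matrix polynomials $G_0,G_1,G_2$, each a sum of at most two symmetric squares, such that $$F(x)=G_0(x)+(x-a)(x-b)\,G_1(x)+(x-a)(c-x)\,G_2(x),$$ and each of the three summands $G_0$, $(x-a)(x-b)G_1$, $(x-a)(c-x)G_2$ has degree at most $n$. (2) If $n$ is odd, then there are $p\times p$ real matrix polynomials $G_0,G_1,G_2,G_3$, each a sum of at most two symmetric squares, such that $$F(x)=(x-a)\,G_0(x)+(c-x)\,G_1(x)+(x-a)^2(x-b)\,G_2(x)+(x-a)(x-b)(c-x)\,G_3(x),$$ and each of the four summands $(x-a)G_0$, $(c-x)G_1$, $(x-a)^2(x-b)G_2$, $(x-a)(x-b)(c-x)G_3$ has degree at most $n$.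 -/

import Mathlib

open Polynomial Matrix

noncomputable section

namespace MatPoly

/-- The degree of a `p × p` real matrix polynomial `F = ∑ i, F_i x^i`: the largest `i` with
`F_i ≠ 0`, that is, the maximal degree of an entry (`⊥` for `F = 0`). -/
def degree {p : ℕ} (F : Matrix (Fin p) (Fin p) ℝ[X]) : WithBot ℕ :=
  Finset.univ.sup fun ij : Fin p × Fin p => (F ij.1 ij.2).degree

/-- The value `F(x)` of a matrix polynomial at a real point. -/
def eval {p : ℕ} (x : ℝ) (F : Matrix (Fin p) (Fin p) ℝ[X]) : Matrix (Fin p) (Fin p) ℝ :=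
  F.map (Polynomial.eval x)

/-- `F` is positive semidefinite at every point of `K`. -/
def PsdOn {p : ℕ} (F : Matrix (Fin p) (Fin p) ℝ[X]) (K : Set ℝ) : Prop :=
  ∀ x ∈ K, (eval x F).PosSemidef

/-- `G` is a sum of at most two symmetric squares `Hᵀ H` of `p × p` real matrix polynomials
(fewer than two squares: take `H = 0`). -/
def IsSumTwoSymmSquares {p : ℕ} (G : Matrix (Fin p) (Fin p) ℝ[X]) : Prop :=
  ∃ H₁ H₂ : Matrix (Fin p) (Fin p) ℝ[X], G = H₁ᵀ * H₁ + H₂ᵀ * H₂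

end MatPoly

end

/-!
Two facts carry the proof: certificates on the interval `[b, c]` alone, and the possibility of
splitting off from such a certificate a sum of squares with a prescribed value at `a`.

For even `n`, write `F = S + (x - b)(c - x) T` with sums of squares `S` and `T`. The weight is
negative at `a`, so `F(a) ≤ S(a)`. If `S = Rᵀ R`, where `R` stacks the two factors, there is a
constant contraction `K` with `(K R(a))ᵀ (K R(a)) = F(a)`, by Douglas' lemma
(`exists_contraction`). Then `G₀ = (K R)ᵀ (K R)` satisfies `G₀ ≤ S ≤ F` on `[b, c]` and
`G₀(a) = F(a)`, so that `F - G₀ = (x - a) P` with `P` positive semidefinite on `[b, c]`. The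
certificate `P = (c - x) U + (x - b) V` for odd degree finishes the proof. For odd `n` the argument
is the same with the two kinds of interval certificates exchanged.

The interval certificates follow from the matrix Fejér–Riesz theorem on the line,
`isSumTwoSymmSquares_of_posSemidef`, by the substitution `x = (b + c t²) / (1 + t²)` and a splitting
into even and odd parts in `t`. The Fejér–Riesz theorem itself is proved over `ℂ[x]`. Symmetric
Gaussian elimination gives `q² F = Hᴴ H` with a scalar polynomial `q`
(`exists_sq_mul_eq_star_mul_self`), and the roots of `q` are removed one at a time: if
`|x - z|² G = Hᴴ H`, then `H(z̄)ᴴ H(z) = 0`, and the orthogonal projection onto the range of `H(z)`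
splits `H` into a part divisible by `x - z̄` and a part divisible by `x - z`
(`exists_star_mul_self_of_mul`). Real and imaginary part of the final factor give the two squares.
-/

namespace MatPoly

/-! ### Nonnegative scalar polynomials -/

/-- Conjugation of the coefficients, the involution for which `star h * h` is the squared modulus
`|h(x)|²` at real points. -/
noncomputable instance polynomialStarRing : StarRing ℂ[X] where
  star f := f.map (starRingEnd ℂ)
  star_involutive f := by
    ext n
    simp
  star_mul f g := by
    rw [Polynomial.map_mul, mul_comm]
  star_add f g := Polynomial.map_add _

theorem star_def (f : ℂ[X]) : star f = f.map (starRingEnd ℂ) := rfl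

theorem eval_star (f : ℂ[X]) (z : ℂ) : (star f).eval z = star (f.eval (star z)) := by
  have h := Polynomial.hom_eval₂ f (RingHom.id ℂ) (starRingEnd ℂ) (star z)
  rw [star_def, Polynomial.eval_map]
  simpa using h.symm

theorem star_X_sub_C (z : ℂ) : star (X - C z) = X - C (star z) := by
  simp [star_def]

theorem star_C (z : ℂ) : star (C z) = C (star z) := by
  simp [star_def]

/-- Real polynomials as complex polynomials. -/
noncomputable def toComplex : ℝ[X] →+* ℂ[X] := Polynomial.mapRingHom Complex.ofRealHom

theorem toComplex_injective : Function.Injective toComplex :=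
  Polynomial.map_injective _ Complex.ofReal_injective

@[simp] theorem star_toComplex (f : ℝ[X]) : star (toComplex f) = toComplex f := by
  ext n
  simp [star_def, toComplex]

@[simp] theorem eval_toComplex (f : ℝ[X]) (x : ℝ) :
    (toComplex f).eval (x : ℂ) = ((f.eval x : ℝ) : ℂ) := by
  simp only [toComplex, Polynomial.coe_mapRingHom]
  exact Polynomial.eval_map_apply (f := Complex.ofRealHom) x

/-- The real quadratic polynomial with roots `z` and its conjugate is `|x - z|²`. -/
theorem toComplex_quadratic (z : ℂ) :
    toComplex (X ^ 2 - C (2 * z.re) * X + C (‖z‖ ^ 2)) = star (X - C z) * (X - C z) := by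
  rw [star_X_sub_C]
  have h1 : (C z + C (star z) : ℂ[X]) = C ((2 * z.re : ℝ) : ℂ) := by
    rw [← C_add]; congr 1; exact Complex.add_conj z
  have h2 : (C z * C (star z) : ℂ[X]) = C ((‖z‖ ^ 2 : ℝ) : ℂ) := by
    rw [← C_mul]; congr 1
    have := Complex.mul_conj' z
    simpa using this
  have h3 : toComplex (X ^ 2 - C (2 * z.re) * X + C (‖z‖ ^ 2))
      = X ^ 2 - C ((2 * z.re : ℝ) : ℂ) * X + C ((‖z‖ ^ 2 : ℝ) : ℂ) := by
    simp [toComplex]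
  rw [h3, ← h1, ← h2]
  ring

theorem eval_quadratic_pos {z : ℂ} {x : ℝ} (h : (x : ℂ) ≠ z) :
    0 < (X ^ 2 - C (2 * z.re) * X + C (‖z‖ ^ 2) : ℝ[X]).eval x := by
  have h1 : (X ^ 2 - C (2 * z.re) * X + C (‖z‖ ^ 2) : ℝ[X]).eval x
      = (x - z.re) ^ 2 + z.im ^ 2 := by
    simp only [eval_add, eval_sub, eval_pow, eval_X, eval_mul, eval_C,
      ← Complex.normSq_eq_norm_sq, Complex.normSq_apply]
    ring
  rw [h1]
  by_contra hn
  have h2 : x - z.re = 0 := by nlinarith [sq_nonneg (x - z.re), sq_nonneg z.im]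
  have h3 : z.im = 0 := by nlinarith [sq_nonneg (x - z.re), sq_nonneg z.im]
  exact h (Complex.ext (by simpa using sub_eq_zero.mp h2) (by simpa using h3.symm))

theorem eval_nonneg_of_forall_ne {f : ℝ[X]} {r : ℝ} (h : ∀ x, x ≠ r → 0 ≤ f.eval x) (x : ℝ) :
    0 ≤ f.eval x := by
  have hc : IsClosed {x : ℝ | 0 ≤ f.eval x} := isClosed_le continuous_const f.continuous
  have hd : Dense ({r}ᶜ : Set ℝ) := dense_compl_singleton r
  exact hc.closure_subset_iff.mpr (fun y hy => h y hy) (hd x)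

/-- A complex root `z` of a nonnegative real polynomial splits off the factor `|x - z|²`: for a
real root, because the root is a minimum and hence has multiplicity at least two. -/
theorem quadratic_dvd_of_nonneg {f : ℝ[X]} (hf : ∀ x, 0 ≤ f.eval x) {z : ℂ}
    (hz : (toComplex f).eval z = 0) :
    X ^ 2 - C (2 * z.re) * X + C (‖z‖ ^ 2) ∣ f := by
  by_cases him : z.im = 0
  · obtain ⟨r, rfl⟩ : ∃ r : ℝ, (r : ℂ) = z := ⟨z.re, Complex.ext (by simp) (by simp [him])⟩
    rw [eval_toComplex] at hz
    have hr : f.eval r = 0 := by exact_mod_cast hz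
    have hd : f.derivative.eval r = 0 := by
      have hmin : IsLocalMin (fun x => f.eval x) r :=
        Filter.Eventually.of_forall fun x => by simpa [hr] using hf x
      simpa using hmin.deriv_eq_zero
    obtain ⟨g, rfl⟩ := Polynomial.dvd_iff_isRoot.mpr hr
    have hg : g.IsRoot r := by simpa using hd
    obtain ⟨k, rfl⟩ := Polynomial.dvd_iff_isRoot.mpr hg
    refine ⟨k, ?_⟩
    simp only [Complex.ofReal_re, Complex.norm_real, Real.norm_eq_abs, sq_abs, C_mul, C_pow]
    have : (C 2 : ℝ[X]) = 2 := rfl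
    rw [this]
    ring
  · refine Polynomial.quadratic_dvd_of_aeval_eq_zero_im_ne_zero f ?_ him
    rw [← hz, toComplex, Polynomial.coe_mapRingHom, Polynomial.eval_map, Polynomial.aeval_def]
    rfl

/-- A nonnegative real polynomial is the squared modulus of a complex polynomial. -/
theorem exists_star_mul_self_of_nonneg (f : ℝ[X]) (hf : ∀ x, 0 ≤ f.eval x) :
    ∃ h : ℂ[X], toComplex f = star h * h := by
  induction hn : f.natDegree using Nat.strong_induction_on generalizing f with
  | _ n ih =>
  by_cases h0 : f.natDegree = 0
  · obtain ⟨c, rfl⟩ := Polynomial.natDegree_eq_zero.mp h0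
    have hc : 0 ≤ c := by simpa using hf 0
    refine ⟨C ((Real.sqrt c : ℝ) : ℂ), ?_⟩
    rw [star_C, ← C_mul]
    simp only [toComplex, Polynomial.coe_mapRingHom, Polynomial.map_C]
    congr 1
    simp only [Complex.ofRealHom_eq_coe, Complex.star_def, Complex.conj_ofReal]
    rw [← Complex.ofReal_mul, Real.mul_self_sqrt hc]
  · have hdeg : (toComplex f).degree ≠ 0 := by
      intro h
      apply h0
      have := Polynomial.natDegree_eq_of_degree_eq_some h
      rwa [toComplex, Polynomial.coe_mapRingHom,
        Polynomial.natDegree_map_eq_of_injective Complex.ofReal_injective] at this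
    obtain ⟨z, hz⟩ := IsAlgClosed.exists_root _ hdeg
    obtain ⟨g, rfl⟩ := quadratic_dvd_of_nonneg hf hz
    have hg : ∀ x, 0 ≤ g.eval x := by
      refine eval_nonneg_of_forall_ne (r := z.re) fun x hx => ?_
      have hp := eval_quadratic_pos (z := z) (x := x) (fun h => hx (by rw [← h]; simp))
      have := hf x
      rw [eval_mul] at this
      exact nonneg_of_mul_nonneg_right this hp
    have hd2 : (X ^ 2 - C (2 * z.re) * X + C (‖z‖ ^ 2) : ℝ[X]).natDegree = 2 := by
      compute_degree!
    have hg0 : g ≠ 0 := by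
      rintro rfl
      simp at h0
    obtain ⟨h, hh⟩ := ih g.natDegree (by
      rw [← hn, Polynomial.natDegree_mul (by rintro h; rw [h] at hd2; simp at hd2) hg0, hd2]
      omega) g hg rfl
    refine ⟨(X - C z) * h, ?_⟩
    rw [map_mul, hh, toComplex_quadratic, star_mul]
    ring

/-! ### Projections onto the range of a matrix -/

open scoped ComplexOrder in
/-- A `{1,3}`-inverse `L` of `M`: the product `M * L` is then the orthogonal projection onto the
range of `M`. It is obtained by solving the normal equations `Mᴴ M L = Mᴴ`. -/
theorem exists_inverse_on_range {𝕜 m n : Type*} [RCLike 𝕜] [Fintype m] [Fintype n]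
    (M : Matrix m n 𝕜) :
    ∃ L : Matrix n m 𝕜, (M * L)ᴴ = M * L ∧ M * L * M = M := by
  classical
  have hle : LinearMap.range (Mᴴ * M).mulVecLin ≤ LinearMap.range Mᴴ.mulVecLin := by
    rw [Matrix.mulVecLin_mul]
    exact LinearMap.range_comp_le_range _ _
  have hrk : Module.finrank 𝕜 (LinearMap.range (Mᴴ * M).mulVecLin)
      = Module.finrank 𝕜 (LinearMap.range Mᴴ.mulVecLin) := by
    have h1 := Matrix.rank_conjTranspose_mul_self M
    have h2 := Matrix.rank_conjTranspose M
    exact h1.trans h2.symm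
  have heq := Submodule.eq_of_le_of_finrank_eq hle hrk
  have hex : ∀ j : m, ∃ v : n → 𝕜, (Mᴴ * M) *ᵥ v = Mᴴ.col j := by
    intro j
    have : Mᴴ.mulVecLin (Pi.single j 1) ∈ LinearMap.range (Mᴴ * M).mulVecLin := by
      rw [heq]
      exact ⟨_, rfl⟩
    simpa [Matrix.mulVec_single_one] using this
  choose v hv using hex
  have hL : Mᴴ * M * (Matrix.of fun i j => v j i) = Mᴴ := by
    ext i j
    have := congrFun (hv j) i
    simpa only [Matrix.mulVec, dotProduct, Matrix.mul_apply, Matrix.of_apply,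
      Matrix.col_apply] using this
  set L : Matrix n m 𝕜 := Matrix.of fun i j => v j i
  have h1 : Lᴴ * Mᴴ * M = M := by
    have := congrArg Matrix.conjTranspose hL
    simpa [Matrix.conjTranspose_mul, Matrix.mul_assoc] using this
  have h2 : (M * L)ᴴ = M * L := by
    have h3 : (M * L)ᴴ * (M * L) = M * L := by
      rw [Matrix.conjTranspose_mul, ← Matrix.mul_assoc, h1]
    have h4 := congrArg Matrix.conjTranspose h3
    rw [Matrix.conjTranspose_mul, Matrix.conjTranspose_conjTranspose, h3] at h4
    exact h4.symm
  refine ⟨L, h2, ?_⟩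
  rw [← h2, Matrix.conjTranspose_mul, h1]

/-! ### The matrix Fejér–Riesz theorem on the line -/

variable {p : ℕ}

theorem posSemidef_real_iff {M : Matrix (Fin p) (Fin p) ℝ} :
    M.PosSemidef ↔ M.IsSymm ∧ ∀ v, 0 ≤ v ⬝ᵥ M *ᵥ v := by
  rw [Matrix.posSemidef_iff_dotProduct_mulVec, Matrix.IsHermitian,
    Matrix.conjTranspose_eq_transpose_of_trivial, Matrix.IsSymm]
  simp

theorem eval_isSymm {F : Matrix (Fin p) (Fin p) ℝ[X]} (hF : F.IsSymm) (x : ℝ) :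
    (eval x F).IsSymm := by
  ext i j
  simp [eval, hF.apply i j]

/-- The Cauchy–Schwarz inequality of a positive semidefinite form, with a basis vector as one of
the two arguments. -/
theorem sq_dotProduct_le {M : Matrix (Fin p) (Fin p) ℝ} (hM : M.PosSemidef) (i : Fin p)
    (v : Fin p → ℝ) : (M i ⬝ᵥ v) ^ 2 ≤ M i i * (v ⬝ᵥ M *ᵥ v) := by
  obtain ⟨hs, hq⟩ := posSemidef_real_iff.mp hM
  have h (s : ℝ) : 0 ≤ M i i * (s * s) + (2 * (M i ⬝ᵥ v)) * s + v ⬝ᵥ M *ᵥ v := by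
    have h1 := hq (s • Pi.single i 1 + v)
    have h2 : v ⬝ᵥ M.col i = M i ⬝ᵥ v := by
      rw [dotProduct_comm]
      congr 1
      ext j
      exact hs.apply i j
    have h3 : (M *ᵥ v) i = M i ⬝ᵥ v := rfl
    simp only [mulVec_add, mulVec_smul, mulVec_single_one, add_dotProduct, smul_dotProduct,
      dotProduct_add, dotProduct_smul, single_one_dotProduct, h2, h3, smul_eq_mul,
      Matrix.col_apply] at h1
    linarith
  have := discrim_le_zero h
  rw [discrim] at this
  nlinarith

/-- A positive semidefinite matrix polynomial is a hermitian square up to the square of a scalar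
factor. This is symmetric Gaussian elimination: with `f` a diagonal entry of `F` and `u` the row
through it, `f F = u uᵀ + E`, where `E` is again positive semidefinite and has one nonzero row
less. The set `s` holds the rows that may still be nonzero; keeping the other rows of the factor
zero leaves room there for the summand `u uᵀ`. -/
theorem exists_sq_mul_eq_star_mul_self (s : Finset (Fin p)) (F : Matrix (Fin p) (Fin p) ℝ[X])
    (hsymm : F.IsSymm) (hF : ∀ x, (eval x F).PosSemidef) (hs : ∀ i ∉ s, ∀ j, F i j = 0) :
    ∃ q : ℝ[X], q ≠ 0 ∧ ∃ H : Matrix (Fin p) (Fin p) ℂ[X], (∀ i ∉ s, ∀ j, H i j = 0) ∧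
      ∀ j k, toComplex (q ^ 2 * F j k) = ∑ l, star (H l j) * H l k := by
  induction s using Finset.induction_on generalizing F with
  | empty => exact ⟨1, one_ne_zero, 0, by simp, by simp [hs]⟩
  | insert i s hi ih =>
    let E : Matrix (Fin p) (Fin p) ℝ[X] := Matrix.of fun j k => F i i * F j k - F i j * F i k
    have hEsymm : E.IsSymm := by
      ext1 j k
      simp only [Matrix.transpose_apply, E, Matrix.of_apply, hsymm.apply j k]
      ring
    have hEv (x : ℝ) (v : Fin p → ℝ) : v ⬝ᵥ eval x E *ᵥ v
        = eval x F i i * (v ⬝ᵥ eval x F *ᵥ v) - (eval x F i ⬝ᵥ v) ^ 2 := by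
      have h1 : eval x E = eval x F i i • eval x F - vecMulVec (eval x F i) (eval x F i) := by
        ext j k
        simp [E, eval, vecMulVec_apply]
      rw [h1, sub_mulVec, smul_mulVec, dotProduct_sub, dotProduct_smul, smul_eq_mul,
        vecMulVec_mulVec, sq]
      simp [dotProduct_smul, dotProduct_comm]
    have hE : ∀ x, (eval x E).PosSemidef := fun x => by
      refine posSemidef_real_iff.mpr ⟨eval_isSymm hEsymm x, fun v => ?_⟩
      rw [hEv]
      exact sub_nonneg.mpr (sq_dotProduct_le (hF x) i v)
    by_cases hf : F i i = 0
    · have hrow : ∀ j, F i j = 0 := by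
        intro j
        refine Polynomial.funext fun x => ?_
        have h1 := sq_dotProduct_le (hF x) i (Pi.single j 1)
        have h2 : eval x F i i = 0 := by simp [eval, hf]
        rw [h2, zero_mul, dotProduct_single_one] at h1
        simpa [eval] using pow_eq_zero_iff two_ne_zero |>.mp (le_antisymm h1 (sq_nonneg _))
      obtain ⟨q, hq, H, hH, h⟩ := ih F hsymm hF fun k hk j => by
        by_cases hki : k = i
        · rw [hki, hrow]
        · exact hs k (by simp [hki, hk]) j
      exact ⟨q, hq, H, fun k hk => hH k fun hks => hk (Finset.mem_insert_of_mem hks), h⟩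
    · obtain ⟨q, hq, K, hK, h⟩ := ih E hEsymm hE fun k hk j => by
        by_cases hki : k = i
        · simp [E, hki]
        · have h1 : ∀ l, F k l = 0 := hs k (by simp [hki, hk])
          simp only [E, Matrix.of_apply, h1 j, ← hsymm.apply i k, h1 i]
          ring
      obtain ⟨g, hg⟩ := exists_star_mul_self_of_nonneg (F i i) fun x => (hF x).diag_nonneg
      refine ⟨F i i * q, mul_ne_zero hf hq,
        Matrix.of fun l j => g * (if l = i then toComplex (q * F i j) else K l j), ?_, ?_⟩
      · intro k hk j
        rw [Finset.mem_insert, not_or] at hk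
        simp [hk.1, hK k hk.2]
      · intro j k
        have h1 : ∀ l, star (g * (if l = i then toComplex (q * F i j) else K l j)) *
            (g * (if l = i then toComplex (q * F i k) else K l k))
            = toComplex (F i i) * ((if l = i then toComplex (q ^ 2 * (F i j * F i k)) else 0) +
              star (K l j) * K l k) := by
          intro l
          rw [hg]
          by_cases hl : l = i
          · simp only [hl, if_true, hK i hi, star_mul, star_toComplex, map_mul, map_pow]
            ring
          · simp only [hl, if_false, star_mul]
            ring
        simp only [Matrix.of_apply, h1]
        rw [← Finset.mul_sum, Finset.sum_add_distrib, ← h]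
        simp only [Finset.sum_ite_eq', Finset.mem_univ, if_true, E, Matrix.of_apply,
          ← map_add, ← map_mul]
        congr 1
        ring

/-- Root removal: if `|x - z|² G` is a hermitian square `Hᴴ H`, then so is `G`. Evaluation at `z`
shows that the ranges of `H(z)` and `H(z̄)` are orthogonal. Hence, for `P` the orthogonal projection
onto the range of `H(z)`, both `P H / (x - z̄)` and `(1 - P) H / (x - z)` are polynomial. -/
theorem exists_star_mul_self_of_mul {G H : Matrix (Fin p) (Fin p) ℂ[X]} (z : ℂ)
    (h : (star (X - C z) * (X - C z)) • G = Hᴴ * H) :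
    ∃ K : Matrix (Fin p) (Fin p) ℂ[X], G = Kᴴ * K := by
  let M := H.map (Polynomial.eval z)
  let N := H.map (Polynomial.eval (star z))
  have hNM : Nᴴ * M = 0 := by
    ext i j
    have h1 := congrArg (Polynomial.eval z) (congrFun (congrFun h i) j)
    simp only [Matrix.smul_apply, smul_eq_mul, eval_mul, eval_sub, eval_X, eval_C, sub_self,
      mul_zero, zero_mul, Matrix.mul_apply, eval_finsetSum, Matrix.conjTranspose_apply,
      eval_star] at h1
    simpa [Matrix.mul_apply, M, N] using h1.symm
  obtain ⟨L, hL, hLM⟩ := exists_inverse_on_range M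
  set P := M * L with hP
  have hPP : P * P = P := by rw [hP, ← Matrix.mul_assoc, hLM]
  have hPN : P * N = 0 := by
    have h1 : Nᴴ * P = 0 := by rw [hP, ← Matrix.mul_assoc, hNM, Matrix.zero_mul]
    have h2 := congrArg Matrix.conjTranspose h1
    rwa [Matrix.conjTranspose_mul, Matrix.conjTranspose_conjTranspose, hL,
      Matrix.conjTranspose_zero] at h2
  have hcM : (1 - P) * M = 0 := by rw [Matrix.sub_mul, hLM, Matrix.one_mul, sub_self]
  -- A constant matrix that annihilates `H(w)` turns `H` into a multiple of `x - w`.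
  have key (w : ℂ) (A : Matrix (Fin p) (Fin p) ℂ) (hA : A * H.map (Polynomial.eval w) = 0) :
      ∃ K : Matrix (Fin p) (Fin p) ℂ[X], A.map C * H = (X - C w) • K := by
    have h1 (i j) : X - C w ∣ (A.map C * H) i j := by
      rw [Polynomial.dvd_iff_isRoot, Polynomial.IsRoot]
      have := congrFun (congrFun hA i) j
      simpa [Matrix.mul_apply, eval_finsetSum] using this
    choose K hK using h1
    exact ⟨Matrix.of K, by ext1 i j; simpa using hK i j⟩
  obtain ⟨K₁, h₁⟩ := key _ P hPN
  obtain ⟨K₂, h₂⟩ := key _ (1 - P) hcM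
  have hPc : (P.map C)ᴴ = P.map C := by
    ext1 i j
    rw [Matrix.conjTranspose_apply, Matrix.map_apply, Matrix.map_apply, star_C]
    congr 1
    exact congrFun (congrFun hL i) j
  have hPPc : P.map C * P.map C = P.map C := by
    rw [← Matrix.map_mul, hPP]
  have h1P : (1 - P).map (C : ℂ → ℂ[X]) = 1 - P.map C := by
    rw [Matrix.map_sub _ (by simp), Matrix.map_one _ (by simp) (by simp)]
  rw [h1P] at h₂
  set Q : Matrix (Fin p) (Fin p) ℂ[X] := P.map C
  set d : ℂ[X] := X - C z with hd
  have hds : X - C (star z) = star d := (star_X_sub_C z).symm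
  rw [hds] at h₁
  have hd0 : star d * d ≠ 0 := by
    rw [← hds]
    exact mul_ne_zero (Polynomial.X_sub_C_ne_zero _) (Polynomial.X_sub_C_ne_zero _)
  have hcross : Qᴴ * (1 - Q) = 0 := by rw [hPc, Matrix.mul_sub, hPPc, Matrix.mul_one, sub_self]
  have hcross' : (1 - Q)ᴴ * Q = 0 := by
    rw [Matrix.conjTranspose_sub, Matrix.conjTranspose_one, hPc, Matrix.sub_mul, hPPc,
      Matrix.one_mul, sub_self]
  have e₁ : (star d * d) • (K₁ᴴ * K₁) = Hᴴ * Q * H := by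
    have : (Q * H)ᴴ * (Q * H) = Hᴴ * Q * H := by
      rw [Matrix.conjTranspose_mul, hPc, ← Matrix.mul_assoc, Matrix.mul_assoc _ Q Q, hPPc]
    rw [← this, h₁, Matrix.conjTranspose_smul, star_star, Matrix.smul_mul, Matrix.mul_smul,
      smul_smul, mul_comm]
  have e₂ : (star d * d) • (K₂ᴴ * K₂) = Hᴴ * (1 - Q) * H := by
    have : ((1 - Q) * H)ᴴ * ((1 - Q) * H) = Hᴴ * (1 - Q) * H := by
      rw [Matrix.conjTranspose_mul, ← Matrix.mul_assoc, Matrix.mul_assoc _ _ (1 - Q),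
        Matrix.mul_sub, hcross', Matrix.mul_one, sub_zero, Matrix.conjTranspose_sub,
        Matrix.conjTranspose_one, hPc]
    rw [← this, h₂, Matrix.conjTranspose_smul, Matrix.smul_mul, Matrix.mul_smul, smul_smul]
  have hmix (A B : Matrix (Fin p) (Fin p) ℂ[X]) (a b : ℂ[X]) (ha : a ≠ 0) (hb : b ≠ 0)
      (hAB : (a • A)ᴴ * (b • B) = 0) : Aᴴ * B = 0 := by
    rw [Matrix.conjTranspose_smul, Matrix.smul_mul, Matrix.mul_smul, smul_smul] at hAB
    refine (smul_eq_zero.mp hAB).resolve_left (mul_ne_zero (star_ne_zero.mpr ha) hb)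
  have hd1 := right_ne_zero_of_mul hd0
  have hd2 := left_ne_zero_of_mul hd0
  have m₁ : K₁ᴴ * K₂ = 0 := by
    refine hmix _ _ _ _ hd2 hd1 ?_
    rw [← h₁, ← h₂, Matrix.conjTranspose_mul, Matrix.mul_assoc, ← Matrix.mul_assoc Qᴴ, hcross]
    simp
  have m₂ : K₂ᴴ * K₁ = 0 := by
    refine hmix _ _ _ _ hd1 hd2 ?_
    rw [← h₁, ← h₂, Matrix.conjTranspose_mul, Matrix.mul_assoc, ← Matrix.mul_assoc _ Q, hcross']
    simp
  refine ⟨K₁ + K₂, smul_right_injective _ hd0 ?_⟩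
  simp only
  rw [h, Matrix.conjTranspose_add, Matrix.add_mul, Matrix.mul_add, Matrix.mul_add, m₁, m₂,
    add_zero, zero_add, smul_add, e₁, e₂, ← Matrix.add_mul, ← Matrix.mul_add, add_sub_cancel,
    Matrix.mul_one]

theorem exists_star_mul_self_of_mul_star_mul {G : Matrix (Fin p) (Fin p) ℂ[X]} (q : ℂ[X])
    (hq : q ≠ 0) (h : ∃ H : Matrix (Fin p) (Fin p) ℂ[X], (star q * q) • G = Hᴴ * H) :
    ∃ K : Matrix (Fin p) (Fin p) ℂ[X], G = Kᴴ * K := by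
  induction hn : q.natDegree using Nat.strong_induction_on generalizing q with
  | _ n ih =>
  obtain ⟨H, h⟩ := h
  by_cases h0 : q.natDegree = 0
  · obtain ⟨c, rfl⟩ := Polynomial.natDegree_eq_zero.mp h0
    have hc : c ≠ 0 := by rintro rfl; simp at hq
    refine ⟨(C c⁻¹) • H, ?_⟩
    rw [Matrix.conjTranspose_smul, Matrix.smul_mul, Matrix.mul_smul, smul_smul, ← h, smul_smul]
    have : (star (C c⁻¹) * C c⁻¹ * (star (C c) * C c) : ℂ[X]) = 1 := by
      rw [star_C, star_C, ← C_mul, ← C_mul, ← C_mul, ← C_1]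
      congr 1
      have hc' : star c ≠ 0 := star_ne_zero.mpr hc
      rw [star_inv₀]
      field_simp
    rw [this, one_smul]
  · obtain ⟨z, hz⟩ := IsAlgClosed.exists_root q fun h => h0
      (Polynomial.natDegree_eq_of_degree_eq_some h)
    obtain ⟨r, rfl⟩ := Polynomial.dvd_iff_isRoot.mpr hz
    have hr : r ≠ 0 := right_ne_zero_of_mul hq
    refine ih r.natDegree ?_ r hr (exists_star_mul_self_of_mul (H := H) z ?_) rfl
    · rw [← hn, Polynomial.natDegree_mul (left_ne_zero_of_mul hq) hr, natDegree_X_sub_C]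
      omega
    · rw [← h, smul_smul, star_mul]
      congr 1
      ring

/-- Real and imaginary part of a complex polynomial on the real line. -/
theorem exists_re_im (h : ℂ[X]) : ∃ u v : ℝ[X], ∀ x : ℝ,
    (h.eval (x : ℂ)).re = u.eval x ∧ (h.eval (x : ℂ)).im = v.eval x := by
  induction h using Polynomial.induction_on' with
  | add f g hf hg =>
    obtain ⟨u, v, h⟩ := hf
    obtain ⟨u', v', h'⟩ := hg
    exact ⟨u + u', v + v', fun x => by simp [h x, h' x]⟩
  | monomial n c =>
    refine ⟨C c.re * X ^ n, C c.im * X ^ n, fun x => ?_⟩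
    rw [eval_monomial, ← Complex.ofReal_pow, Complex.re_mul_ofReal, Complex.im_mul_ofReal]
    simp

/-- The matrix Fejér–Riesz theorem on the line. -/
theorem isSumTwoSymmSquares_of_posSemidef {F : Matrix (Fin p) (Fin p) ℝ[X]} (hsymm : F.IsSymm)
    (hF : ∀ x, (eval x F).PosSemidef) : IsSumTwoSymmSquares F := by
  obtain ⟨q, hq, H, -, h⟩ := exists_sq_mul_eq_star_mul_self Finset.univ F hsymm hF (by simp)
  obtain ⟨K, hK⟩ := exists_star_mul_self_of_mul_star_mul (G := F.map toComplex) (toComplex q)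
    ((map_ne_zero_iff _ toComplex_injective).mpr hq) ⟨H, by
      ext1 i j
      simpa [Matrix.mul_apply, sq] using h i j⟩
  choose A B hAB using fun i j => exists_re_im (K i j)
  refine ⟨Matrix.of A, Matrix.of B, ?_⟩
  ext1 i j
  refine Polynomial.funext fun x => ?_
  have h1 := congrArg (fun f => (Polynomial.eval (x : ℂ) f).re) (congrFun (congrFun hK i) j)
  simp only [Matrix.map_apply, eval_toComplex, Complex.ofReal_re, Matrix.mul_apply,
    eval_finsetSum, Complex.re_sum, Matrix.conjTranspose_apply, eval_mul, eval_star] at h1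
  rw [h1]
  simp [Matrix.mul_apply, eval_finsetSum, (hAB _ _ x).1, (hAB _ _ x).2, Finset.sum_add_distrib]

/-! ### Sums of two squares with degree bounds -/

theorem natDegree_le_of_eval_le {f g : ℝ[X]} (h0 : ∀ x, 0 ≤ g.eval x)
    (h : ∀ x, g.eval x ≤ f.eval x) : g.natDegree ≤ f.natDegree := by
  by_contra! hlt
  have hg : g ≠ 0 := by rintro rfl; simp at hlt
  have hlim := Polynomial.div_tendsto_atTop_zero_of_degree_lt f g
    (Polynomial.degree_lt_degree hlt)
  have hroot := Polynomial.eventually_atTop_not_isRoot g hg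
  refine absurd (ge_of_tendsto (b := 1) hlim ?_) (by norm_num)
  filter_upwards [hroot] with x hx
  have hpos : 0 < g.eval x := lt_of_le_of_ne (h0 x) (Ne.symm hx)
  exact (one_le_div hpos).mpr (h x)

/-- `S` is a sum of two symmetric squares of matrix polynomials of degree at most `d`. -/
def IsSumTwoSymmSquaresOfDegree (d : ℕ) (S : Matrix (Fin p) (Fin p) ℝ[X]) : Prop :=
  ∃ A B : Matrix (Fin p) (Fin p) ℝ[X], (∀ i j, (A i j).natDegree ≤ d) ∧
    (∀ i j, (B i j).natDegree ≤ d) ∧ S = Aᵀ * A + Bᵀ * B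

namespace IsSumTwoSymmSquaresOfDegree

variable {d : ℕ} {S : Matrix (Fin p) (Fin p) ℝ[X]}

theorem isSumTwoSymmSquares (h : IsSumTwoSymmSquaresOfDegree d S) : IsSumTwoSymmSquares S := by
  obtain ⟨A, B, -, -, h⟩ := h
  exact ⟨A, B, h⟩

theorem natDegree_le (h : IsSumTwoSymmSquaresOfDegree d S) (i j : Fin p) :
    (S i j).natDegree ≤ 2 * d := by
  obtain ⟨A, B, hA, hB, rfl⟩ := h
  have aux (A : Matrix (Fin p) (Fin p) ℝ[X]) (hA : ∀ i j, (A i j).natDegree ≤ d) :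
      ((Aᵀ * A) i j).natDegree ≤ 2 * d := by
    rw [Matrix.mul_apply]
    refine Polynomial.natDegree_sum_le_of_forall_le _ _ fun k _ => ?_
    exact (Polynomial.natDegree_mul_le_of_le (hA k i) (hA k j)).trans (by omega)
  exact Polynomial.natDegree_add_le_of_degree_le (aux A hA) (aux B hB)

end IsSumTwoSymmSquaresOfDegree

theorem IsSumTwoSymmSquares.isSymm {S : Matrix (Fin p) (Fin p) ℝ[X]}
    (h : IsSumTwoSymmSquares S) : S.IsSymm := by
  obtain ⟨A, B, rfl⟩ := h
  simp [Matrix.IsSymm, Matrix.transpose_add, Matrix.transpose_mul]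

theorem eval_add (x : ℝ) (F G : Matrix (Fin p) (Fin p) ℝ[X]) :
    eval x (F + G) = eval x F + eval x G := by
  ext i j; simp [eval]

theorem eval_sub (x : ℝ) (F G : Matrix (Fin p) (Fin p) ℝ[X]) :
    eval x (F - G) = eval x F - eval x G := by
  ext i j; simp [eval]

theorem eval_smul (x : ℝ) (f : ℝ[X]) (G : Matrix (Fin p) (Fin p) ℝ[X]) :
    eval x (f • G) = f.eval x • eval x G := by
  ext i j; simp [eval]

theorem IsSumTwoSymmSquares.posSemidef {S : Matrix (Fin p) (Fin p) ℝ[X]}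
    (h : IsSumTwoSymmSquares S) (x : ℝ) : (eval x S).PosSemidef := by
  obtain ⟨A, B, rfl⟩ := h
  have aux (A : Matrix (Fin p) (Fin p) ℝ[X]) : eval x (Aᵀ * A) = (eval x A)ᴴ * eval x A := by
    ext i j
    simp [eval, Matrix.mul_apply, eval_finsetSum]
  rw [eval_add, aux, aux]
  exact (posSemidef_conjTranspose_mul_self _).add (posSemidef_conjTranspose_mul_self _)

/-- The degrees in a sum of squares are controlled by the sum, as leading terms cannot cancel. -/
theorem IsSumTwoSymmSquares.ofDegree {S : Matrix (Fin p) (Fin p) ℝ[X]}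
    (h : IsSumTwoSymmSquares S) {d : ℕ} (hd : ∀ i j, (S i j).natDegree ≤ 2 * d) :
    IsSumTwoSymmSquaresOfDegree d S := by
  obtain ⟨A, B, rfl⟩ := h
  have hS (j : Fin p) (x : ℝ) : ((Aᵀ * A + Bᵀ * B) j j).eval x
      = ∑ k, (((A k j).eval x) ^ 2 + ((B k j).eval x) ^ 2) := by
    simp [Matrix.mul_apply, eval_finsetSum, Finset.sum_add_distrib, sq]
  have aux (g : ℝ[X]) (i j : Fin p)
      (hg : ∀ x, (g.eval x) ^ 2 ≤ ((A i j).eval x) ^ 2 + ((B i j).eval x) ^ 2) :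
      g.natDegree ≤ d := by
    have h1 : (g ^ 2).natDegree ≤ ((Aᵀ * A + Bᵀ * B) j j).natDegree := by
      refine natDegree_le_of_eval_le (fun x => by rw [eval_pow]; positivity) fun x => ?_
      rw [hS, eval_pow]
      exact (hg x).trans (Finset.single_le_sum
        (f := fun k => ((A k j).eval x) ^ 2 + ((B k j).eval x) ^ 2)
        (fun k _ => by positivity) (Finset.mem_univ i))
    rw [natDegree_pow] at h1
    have := hd j j
    omega
  exact ⟨A, B, fun i j => aux _ i j fun x => le_add_of_nonneg_right (sq_nonneg _),
    fun i j => aux _ i j fun x => le_add_of_nonneg_left (sq_nonneg _), rfl⟩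

/-! ### Certificates on the half-line and on intervals -/

/-- The polynomial `v ^ n f(u / v)`, for `f` of degree at most `n`. -/
noncomputable def homogenize (n : ℕ) (u v f : ℝ[X]) : ℝ[X] :=
  ∑ k ∈ Finset.range (n + 1), C (f.coeff k) * u ^ k * v ^ (n - k)

theorem eval_homogenize {n : ℕ} {u v f : ℝ[X]} (hf : f.natDegree ≤ n) {x : ℝ}
    (hv : v.eval x ≠ 0) :
    (homogenize n u v f).eval x = v.eval x ^ n * f.eval (u.eval x / v.eval x) := by
  rw [homogenize, eval_finsetSum, Polynomial.eval_eq_sum_range' (Nat.lt_succ_of_le hf),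
    Finset.mul_sum]
  refine Finset.sum_congr rfl fun k hk => ?_
  have hk' : k ≤ n := Nat.lt_succ_iff.mp (Finset.mem_range.mp hk)
  simp only [eval_mul, eval_C, eval_pow]
  rw [div_pow, ← Nat.sub_add_cancel hk', pow_add, Nat.add_sub_cancel]
  field_simp

theorem natDegree_homogenize_le {n : ℕ} {u v f : ℝ[X]} (hu : u.natDegree ≤ 1)
    (hv : v.natDegree ≤ 1) : (homogenize n u v f).natDegree ≤ n := by
  refine Polynomial.natDegree_sum_le_of_forall_le _ _ fun k hk => ?_
  have hk' : k ≤ n := Nat.lt_succ_iff.mp (Finset.mem_range.mp hk)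
  have h1 := Polynomial.natDegree_pow_le_of_le k hu
  have h2 := Polynomial.natDegree_pow_le_of_le (n - k) hv
  have h3 := Polynomial.natDegree_mul_le_of_le
    (Polynomial.natDegree_mul_le_of_le (Polynomial.natDegree_C (f.coeff k)).le h1) h2
  exact h3.trans (by omega)

/-- Splitting into even and odd part, `f(t) = g(t²) + t h(t²)`. -/
theorem exists_even_odd (f : ℝ[X]) : ∃ g h : ℝ[X], f = expand ℝ 2 g + X * expand ℝ 2 h ∧
    2 * g.natDegree ≤ f.natDegree ∧ ∀ m, f.natDegree ≤ 2 * m + 2 → h.natDegree ≤ m := by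
  refine ⟨contract 2 f, contract 2 f.divX, ?_, ?_, ?_⟩
  · ext n
    rcases Nat.even_or_odd' n with ⟨k, rfl | rfl⟩
    · rw [coeff_add, mul_comm 2 k, coeff_expand_mul two_pos, coeff_contract two_ne_zero]
      rcases k with _ | k
      · simp
      · have : (k + 1) * 2 = (2 * k + 1) + 1 := by ring
        rw [this, coeff_X_mul, coeff_expand two_pos, if_neg (by omega), add_zero]
    · rw [coeff_add, coeff_X_mul, mul_comm 2 k, coeff_expand_mul two_pos,
        coeff_contract two_ne_zero, coeff_divX, coeff_expand two_pos, if_neg (by omega), zero_add]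
  · have : (contract 2 f).natDegree ≤ f.natDegree / 2 :=
      natDegree_le_iff_coeff_eq_zero.mpr fun N hN => by
        rw [coeff_contract two_ne_zero]
        exact coeff_eq_zero_of_natDegree_lt (by omega)
    omega
  · intro m hm
    refine natDegree_le_iff_coeff_eq_zero.mpr fun N hN => ?_
    rw [coeff_contract two_ne_zero, coeff_divX]
    exact coeff_eq_zero_of_natDegree_lt (by omega)

theorem eq_of_expand_eq {f g h : ℝ[X]} (e : expand ℝ 2 f = expand ℝ 2 g + X * expand ℝ 2 h) :
    f = g := by
  ext n
  have h1 := congrArg (fun r => coeff r (n * 2)) e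
  simp only [coeff_add, coeff_expand_mul two_pos] at h1
  rcases n with _ | k
  · simpa using h1
  · have : (k + 1) * 2 = (2 * k + 1) + 1 := by ring
    rwa [this, coeff_X_mul, coeff_expand two_pos, if_neg (by omega), add_zero] at h1

/-- A matrix polynomial that is positive semidefinite on the half-line is `S + s T` with sums of
squares `S` and `T`: these come from the even and the odd part, with respect to `t`, of the factors
of `F(t²)`. -/
theorem exists_of_posSemidef_halfLine {F : Matrix (Fin p) (Fin p) ℝ[X]} (hsymm : F.IsSymm) {n : ℕ}
    (hdeg : ∀ i j, (F i j).natDegree ≤ n) (hF : ∀ s, 0 ≤ s → (eval s F).PosSemidef) :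
    ∃ S T : Matrix (Fin p) (Fin p) ℝ[X], IsSumTwoSymmSquaresOfDegree (n / 2) S ∧
      (∀ m, n ≤ 2 * m + 2 → IsSumTwoSymmSquaresOfDegree m T) ∧ F = S + (X : ℝ[X]) • T := by
  have hsq : IsSumTwoSymmSquares (F.map (expand ℝ 2)) := by
    refine isSumTwoSymmSquares_of_posSemidef ?_ fun t => ?_
    · ext1 i j
      simp [hsymm.apply i j]
    · convert hF (t ^ 2) (sq_nonneg t) using 1
      ext i j
      simp [eval, expand_eval]
  obtain ⟨A, B, hA, hB, h⟩ := hsq.ofDegree (d := n) fun i j => by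
    rw [Matrix.map_apply, natDegree_expand, mul_comm]
    exact Nat.mul_le_mul_left 2 (hdeg i j)
  choose A₀ A₁ hA' hA₀ hA₁ using fun i j => exists_even_odd (A i j)
  choose B₀ B₁ hB' hB₀ hB₁ using fun i j => exists_even_odd (B i j)
  refine ⟨(of A₀)ᵀ * of A₀ + (of B₀)ᵀ * of B₀, (of A₁)ᵀ * of A₁ + (of B₁)ᵀ * of B₁, ?_, ?_, ?_⟩
  · refine ⟨_, _, fun i j => ?_, fun i j => ?_, rfl⟩
    · have := hA₀ i j
      have := hA i j
      rw [of_apply]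
      omega
    · have := hB₀ i j
      have := hB i j
      rw [of_apply]
      omega
  · exact fun m hm => ⟨_, _, fun i j => hA₁ i j m ((hA i j).trans hm),
      fun i j => hB₁ i j m ((hB i j).trans hm), rfl⟩
  · ext1 i j
    refine eq_of_expand_eq (h := ∑ k, (A₀ k i * A₁ k j + A₁ k i * A₀ k j +
      (B₀ k i * B₁ k j + B₁ k i * B₀ k j))) ?_
    have h1 := congrFun (congrFun h i) j
    rw [Matrix.map_apply] at h1
    rw [h1]
    simp only [Matrix.add_apply, Matrix.smul_apply, Matrix.mul_apply, Matrix.transpose_apply,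
      of_apply, map_add, map_sum, map_mul, smul_eq_mul, expand_X, Finset.mul_sum,
      ← Finset.sum_add_distrib]
    refine Finset.sum_congr rfl fun k _ => ?_
    rw [hA' k i, hA' k j, hB' k i, hB' k j]
    ring

/-- Homogenization of the factors turns a sum of squares in `s = (x - b) / (c - x)` into one
in `x`. -/
theorem IsSumTwoSymmSquaresOfDegree.exists_homogenize {d : ℕ} {S : Matrix (Fin p) (Fin p) ℝ[X]}
    (h : IsSumTwoSymmSquaresOfDegree d S) (b c : ℝ) {κ : ℝ} (hκ : 0 ≤ κ) :
    ∃ S' : Matrix (Fin p) (Fin p) ℝ[X], IsSumTwoSymmSquaresOfDegree d S' ∧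
      ∀ x, x ≠ c → ∀ i j, (S' i j).eval x =
        κ * ((c - x) ^ (2 * d) * (S i j).eval ((x - b) / (c - x))) := by
  obtain ⟨A, B, hA, hB, rfl⟩ := h
  let A' : Matrix (Fin p) (Fin p) ℝ[X] :=
    A.map fun f => C (Real.sqrt κ) * homogenize d (X - C b) (C c - X) f
  let B' : Matrix (Fin p) (Fin p) ℝ[X] :=
    B.map fun f => C (Real.sqrt κ) * homogenize d (X - C b) (C c - X) f
  have hd (f : ℝ[X]) :
      (C (Real.sqrt κ) * homogenize d (X - C b) (C c - X) f).natDegree ≤ d := by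
    refine (natDegree_C_mul_le _ _).trans (natDegree_homogenize_le ?_ ?_)
    · exact natDegree_X_sub_C_le b
    · compute_degree
  refine ⟨A'ᵀ * A' + B'ᵀ * B', ⟨A', B', fun i j => hd _, fun i j => hd _, rfl⟩, ?_⟩
  intro x hx i j
  have hcx : (C c - X : ℝ[X]).eval x ≠ 0 := by simpa using sub_ne_zero.mpr (Ne.symm hx)
  have key (f g : ℝ[X]) (hf : f.natDegree ≤ d) (hg : g.natDegree ≤ d) :
      (C (Real.sqrt κ) * homogenize d (X - C b) (C c - X) f *
        (C (Real.sqrt κ) * homogenize d (X - C b) (C c - X) g)).eval x =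
      κ * ((c - x) ^ (2 * d) * (f * g).eval ((x - b) / (c - x))) := by
    rw [eval_mul, eval_mul, eval_mul, eval_mul, eval_homogenize hf hcx, eval_homogenize hg hcx]
    simp only [eval_C, Polynomial.eval_sub, eval_X]
    nth_rewrite 3 [← Real.mul_self_sqrt hκ]
    ring
  simp only [Matrix.add_apply, Matrix.mul_apply, Matrix.transpose_apply, A', B',
    Matrix.map_apply, Polynomial.eval_add, eval_finsetSum,
    key _ _ (hA _ _) (hA _ _), key _ _ (hB _ _) (hB _ _), mul_add, Finset.mul_sum]

/-- Under `x = (b + c s) / (1 + s)` the half-line corresponds to `[b, c)`. -/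
theorem exists_of_posSemidef_Icc {F : Matrix (Fin p) (Fin p) ℝ[X]} (hsymm : F.IsSymm) {n : ℕ}
    (hdeg : ∀ i j, (F i j).natDegree ≤ n) {b c : ℝ} (hbc : b < c) (hF : PsdOn F (Set.Icc b c)) :
    ∃ S T : Matrix (Fin p) (Fin p) ℝ[X], IsSumTwoSymmSquaresOfDegree (n / 2) S ∧
      (∀ m, n ≤ 2 * m + 2 → IsSumTwoSymmSquaresOfDegree m T) ∧
      ∀ x, x ≠ c → ∀ i j, (F i j).eval x = ((c - b) ^ n)⁻¹ * (c - x) ^ n *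
        ((S i j).eval ((x - b) / (c - x)) +
          (x - b) / (c - x) * (T i j).eval ((x - b) / (c - x))) := by
  let Q : Matrix (Fin p) (Fin p) ℝ[X] := F.map (homogenize n (C b + C c * X) (1 + X))
  have hQ {s : ℝ} (hs : 1 + s ≠ 0) (i j : Fin p) :
      (Q i j).eval s = (1 + s) ^ n * (F i j).eval ((b + c * s) / (1 + s)) := by
    simp only [Q, Matrix.map_apply]
    rw [eval_homogenize (hdeg i j) (by simpa using hs)]
    simp
  obtain ⟨S, T, hS, hT, hST⟩ := exists_of_posSemidef_halfLine (F := Q) (n := n)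
    (by ext1 i j; simp [Q, hsymm.apply i j])
    (fun i j => natDegree_homogenize_le (by compute_degree) (by compute_degree))
    (fun s hs => by
      have h1 : 0 < 1 + s := by linarith
      have h2 : eval s Q = (1 + s) ^ n • eval ((b + c * s) / (1 + s)) F := by
        ext i j
        exact hQ h1.ne' i j
      rw [h2]
      refine (hF _ ⟨?_, ?_⟩).smul (by positivity)
      · rw [le_div_iff₀ h1]; nlinarith
      · rw [div_le_iff₀ h1]; nlinarith)
  refine ⟨S, T, hS, hT, fun x hx i j => ?_⟩
  have hcx : c - x ≠ 0 := sub_ne_zero.mpr (Ne.symm hx)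
  have hcb : c - b ≠ 0 := (sub_pos.mpr hbc).ne'
  have h1 : 1 + (x - b) / (c - x) = (c - b) / (c - x) := by field_simp; ring
  have h2 : (b + c * ((x - b) / (c - x))) / ((c - b) / (c - x)) = x := by field_simp; ring
  have h3 := hQ (s := (x - b) / (c - x)) (by rw [h1]; exact div_ne_zero hcb hcx) i j
  rw [h1, h2, hST] at h3
  simp only [Matrix.add_apply, Matrix.smul_apply, smul_eq_mul, Polynomial.eval_add, eval_mul,
    eval_X] at h3
  rw [h3, div_pow]
  field_simp

theorem eq_of_eval_eq_of_ne {f g : ℝ[X]} {c : ℝ} (h : ∀ x, x ≠ c → f.eval x = g.eval x) :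
    f = g :=
  Polynomial.eq_of_infinite_eval_eq f g <|
    (Set.Infinite.mono fun x hx => h x hx) (Set.finite_singleton c).infinite_compl

/-- Positivity certificate on an interval, odd degree. -/
theorem exists_of_posSemidef_Icc_odd {F : Matrix (Fin p) (Fin p) ℝ[X]} (hsymm : F.IsSymm) {m : ℕ}
    (hdeg : ∀ i j, (F i j).natDegree ≤ 2 * m + 1) {b c : ℝ} (hbc : b < c)
    (hF : PsdOn F (Set.Icc b c)) :
    ∃ S T : Matrix (Fin p) (Fin p) ℝ[X], IsSumTwoSymmSquaresOfDegree m S ∧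
      IsSumTwoSymmSquaresOfDegree m T ∧ F = (C c - X) • S + (X - C b) • T := by
  obtain ⟨S, T, hS, hT, h⟩ := exists_of_posSemidef_Icc hsymm hdeg hbc hF
  have hκ : 0 ≤ ((c - b) ^ (2 * m + 1))⁻¹ := inv_nonneg.mpr (pow_nonneg (sub_pos.mpr hbc).le _)
  rw [show (2 * m + 1) / 2 = m by omega] at hS
  obtain ⟨S', hS', hSe⟩ := hS.exists_homogenize b c hκ
  obtain ⟨T', hT', hTe⟩ := (hT m (by omega)).exists_homogenize b c hκ
  refine ⟨S', T', hS', hT', ?_⟩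
  ext1 i j
  refine eq_of_eval_eq_of_ne (c := c) fun x hx => ?_
  have hcx : c - x ≠ 0 := sub_ne_zero.mpr (Ne.symm hx)
  simp only [Matrix.add_apply, Matrix.smul_apply, smul_eq_mul, Polynomial.eval_add, eval_mul,
    Polynomial.eval_sub, eval_X, eval_C, hSe x hx, hTe x hx, h x hx]
  field_simp
  ring

/-- Positivity certificate on an interval, even degree. -/
theorem exists_of_posSemidef_Icc_even {F : Matrix (Fin p) (Fin p) ℝ[X]} (hsymm : F.IsSymm) {m : ℕ}
    (hdeg : ∀ i j, (F i j).natDegree ≤ 2 * m) {b c : ℝ} (hbc : b < c)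
    (hF : PsdOn F (Set.Icc b c)) :
    ∃ S T : Matrix (Fin p) (Fin p) ℝ[X], IsSumTwoSymmSquaresOfDegree m S ∧
      IsSumTwoSymmSquares T ∧ (∀ i j, (T i j = 0 ∨ (T i j).natDegree + 2 ≤ 2 * m)) ∧
      F = S + ((X - C b) * (C c - X)) • T := by
  rcases m with _ | m
  · have hconst (x : ℝ) : eval x F = eval b F := by
      ext i j
      rw [eval, eval, Matrix.map_apply, Matrix.map_apply,
        Polynomial.eq_C_of_natDegree_le_zero (hdeg i j), eval_C, eval_C]
    have hsq := isSumTwoSymmSquares_of_posSemidef hsymm fun x => by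
      rw [hconst]
      exact hF b ⟨le_rfl, hbc.le⟩
    exact ⟨F, 0, hsq.ofDegree hdeg, ⟨0, 0, by simp⟩, by simp, by simp⟩
  obtain ⟨S, T, hS, hT, h⟩ := exists_of_posSemidef_Icc hsymm hdeg hbc hF
  have hκ : 0 ≤ ((c - b) ^ (2 * (m + 1)))⁻¹ := inv_nonneg.mpr (pow_nonneg (sub_pos.mpr hbc).le _)
  rw [show (2 * (m + 1)) / 2 = m + 1 by omega] at hS
  obtain ⟨S', hS', hSe⟩ := hS.exists_homogenize b c hκ
  obtain ⟨T', hT', hTe⟩ := (hT m (by omega)).exists_homogenize b c hκ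
  refine ⟨S', T', hS', hT'.isSumTwoSymmSquares,
    fun i j => Or.inr (by have := hT'.natDegree_le i j; omega), ?_⟩
  ext1 i j
  refine eq_of_eval_eq_of_ne (c := c) fun x hx => ?_
  have hcx : c - x ≠ 0 := sub_ne_zero.mpr (Ne.symm hx)
  simp only [Matrix.add_apply, Matrix.smul_apply, smul_eq_mul, Polynomial.eval_add, eval_mul,
    Polynomial.eval_sub, eval_X, eval_C, hSe x hx, hTe x hx, h x hx]
  field_simp
  ring

/-! ### Sums of squares with a prescribed value at a point -/

open scoped MatrixOrder in
/-- A form of Douglas' lemma: a positive semidefinite `N ≤ Rᵀ R` is `(K R)ᵀ (K R)` for a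
contraction `K`. Writing `N = Dᵀ D`, the contraction is `D` composed with a `{1,3}`-inverse of
`R`. -/
theorem exists_contraction {ι κ : Type*} [Fintype ι] [DecidableEq ι] [Fintype κ]
    [DecidableEq κ] {N : Matrix ι ι ℝ} (hN : N.PosSemidef) (R : Matrix κ ι ℝ) (hNR : (Rᵀ * R - N).PosSemidef) :
    ∃ K : Matrix ι κ ℝ, (1 - Kᵀ * K).PosSemidef ∧ (K * R)ᵀ * (K * R) = N := by
  obtain ⟨D, rfl⟩ := CStarAlgebra.nonneg_iff_eq_star_mul_self.mp hN.nonneg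
  obtain ⟨L, hL, hLR⟩ := exists_inverse_on_range R
  simp only [star_eq_conjTranspose, conjTranspose_eq_transpose_of_trivial] at *
  have hD : D * L * R = D := by
    have h1 : R * (L * R - 1) = 0 := by
      rw [Matrix.mul_sub, ← Matrix.mul_assoc, hLR, Matrix.mul_one, sub_self]
    have h2 : (-((D * (L * R - 1))ᴴ * (D * (L * R - 1)))).PosSemidef := by
      have h3 := hNR.conjTranspose_mul_mul_same (L * R - 1)
      have h4 : (L * R - 1)ᴴ * (Rᵀ * R - Dᵀ * D) * (L * R - 1)
          = (L * R - 1)ᴴ * Rᵀ * (R * (L * R - 1)) -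
            (D * (L * R - 1))ᴴ * (D * (L * R - 1)) := by
        rw [Matrix.conjTranspose_mul, Matrix.conjTranspose_eq_transpose_of_trivial D]
        simp only [Matrix.mul_sub, Matrix.sub_mul, Matrix.mul_assoc]
        abel
      rwa [h4, h1, Matrix.mul_zero, zero_sub] at h3
    have h5 := (posSemidef_conjTranspose_mul_self (D * (L * R - 1))).nonneg
    have h6 := Matrix.conjTranspose_mul_self_eq_zero.mp
      (le_antisymm (neg_nonneg.mp h2.nonneg) h5)
    rw [Matrix.mul_sub, Matrix.mul_one, sub_eq_zero] at h6
    rw [Matrix.mul_assoc, h6]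
  refine ⟨D * L, ?_, by rw [hD]⟩
  have hidem : (R * L)ᵀ * (R * L) = R * L := by rw [hL, ← Matrix.mul_assoc, hLR]
  have e₁ : 1 - R * L = (1 - R * L)ᴴ * (1 - R * L) := by
    rw [Matrix.conjTranspose_eq_transpose_of_trivial, Matrix.transpose_sub, Matrix.transpose_one,
      Matrix.sub_mul, Matrix.mul_sub, Matrix.mul_sub, hidem, hL, Matrix.one_mul, Matrix.mul_one,
      Matrix.one_mul, sub_self, sub_zero]
  have e₂ : 1 - (D * L)ᵀ * (D * L) = (1 - R * L) + Lᴴ * (Rᵀ * R - Dᵀ * D) * L := by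
    have h1 : Lᴴ * (Rᵀ * R - Dᵀ * D) * L = (R * L)ᵀ * (R * L) - (D * L)ᵀ * (D * L) := by
      rw [Matrix.conjTranspose_eq_transpose_of_trivial, Matrix.transpose_mul,
        Matrix.transpose_mul]
      simp only [Matrix.mul_sub, Matrix.sub_mul, Matrix.mul_assoc]
    rw [h1, hidem]
    abel
  have h₁ : (1 - R * L).PosSemidef := by
    rw [e₁]
    exact posSemidef_conjTranspose_mul_self _
  rw [e₂]
  exact h₁.add (hNR.conjTranspose_mul_mul_same L)

/-- Below a sum of squares `S` there is a sum of squares with any prescribed value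
`0 ≤ N ≤ S(a)` at a point `a`: with `S = Rᵀ R`, multiply `R` by a constant contraction. -/
theorem IsSumTwoSymmSquaresOfDegree.exists_le_of_eval_le {d : ℕ}
    {S : Matrix (Fin p) (Fin p) ℝ[X]} (hS : IsSumTwoSymmSquaresOfDegree d S)
    {N : Matrix (Fin p) (Fin p) ℝ} (hN : N.PosSemidef) {a : ℝ}
    (hNS : (eval a S - N).PosSemidef) :
    ∃ G : Matrix (Fin p) (Fin p) ℝ[X], IsSumTwoSymmSquaresOfDegree d G ∧ eval a G = N ∧
      ∀ x, (eval x S - eval x G).PosSemidef := by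
  obtain ⟨A, B, hA, hB, rfl⟩ := hS
  let R (x : ℝ) : Matrix (Fin p ⊕ Fin p) (Fin p) ℝ := Matrix.fromRows (eval x A) (eval x B)
  have hR (x : ℝ) : eval x (Aᵀ * A + Bᵀ * B) = (R x)ᵀ * R x := by
    rw [Matrix.transpose_fromRows, Matrix.fromCols_mul_fromRows]
    ext i j
    simp [eval, Matrix.mul_apply, eval_finsetSum]
  rw [hR] at hNS
  obtain ⟨K, hK, hKR⟩ := exists_contraction hN (R a) hNS
  let H : Matrix (Fin p) (Fin p) ℝ[X] := K.map C * Matrix.fromRows A B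
  have hH (x : ℝ) : eval x (Hᵀ * H) = (K * R x)ᵀ * (K * R x) := by
    have h1 : eval x H = K * R x := by
      ext i j
      simp [eval, H, R, Matrix.mul_apply, eval_finsetSum]
    rw [← h1]
    ext i j
    simp [eval, Matrix.mul_apply, eval_finsetSum]
  refine ⟨Hᵀ * H, ⟨H, 0, fun i j => ?_, by simp, by simp⟩, by rw [hH, hKR], fun x => ?_⟩
  · simp only [H, Matrix.mul_apply]
    refine Polynomial.natDegree_sum_le_of_forall_le _ _ fun k _ => ?_
    refine (natDegree_C_mul_le _ _).trans ?_
    rcases k with k | k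
    · exact hA k j
    · exact hB k j
  · rw [hR, hH]
    have h1 := hK.conjTranspose_mul_mul_same (R x)
    convert h1 using 1
    rw [Matrix.conjTranspose_eq_transpose_of_trivial, Matrix.transpose_mul, Matrix.mul_sub,
      Matrix.sub_mul, Matrix.mul_one]
    simp only [Matrix.mul_assoc]

/-! ### A point and an interval -/

/-- Division by `x - a` keeps positivity to the right of `a`. -/
theorem exists_eq_X_sub_C_smul {E : Matrix (Fin p) (Fin p) ℝ[X]} (hsymm : E.IsSymm) {n : ℕ}
    (hdeg : ∀ i j, (E i j).natDegree ≤ n + 1) {a b c : ℝ} (hab : a < b) (h0 : eval a E = 0)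
    (hE : PsdOn E (Set.Icc b c)) :
    ∃ P : Matrix (Fin p) (Fin p) ℝ[X], P.IsSymm ∧ (∀ i j, (P i j).natDegree ≤ n) ∧
      PsdOn P (Set.Icc b c) ∧ E = (X - C a : ℝ[X]) • P := by
  have hEP : E = (X - C a : ℝ[X]) • E.map (· /ₘ (X - C a)) := by
    ext1 i j
    exact (mul_divByMonic_eq_iff_isRoot.mpr (congrFun (congrFun h0 i) j)).symm
  refine ⟨E.map (· /ₘ (X - C a)), ?_, fun i j => ?_, fun x hx => ?_, hEP⟩
  · ext1 i j
    simp [hsymm.apply i j]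
  · rw [Matrix.map_apply, natDegree_divByMonic _ (monic_X_sub_C a), natDegree_X_sub_C]
    have := hdeg i j
    omega
  · have hxa : 0 < x - a := by linarith [hx.1]
    have h1 := hE x hx
    rw [hEP, eval_smul] at h1
    have h2 := h1.smul (inv_nonneg.mpr hxa.le)
    rwa [smul_smul, Polynomial.eval_sub, eval_X, eval_C, inv_mul_cancel₀ hxa.ne',
      one_smul] at h2

theorem degree_le_iff {F : Matrix (Fin p) (Fin p) ℝ[X]} {n : ℕ} :
    degree F ≤ (n : WithBot ℕ) ↔ ∀ i j, (F i j).natDegree ≤ n := by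
  simp [degree, Finset.sup_le_iff, natDegree_le_iff_degree_le]

theorem natDegree_smul_le {f : ℝ[X]} {G : Matrix (Fin p) (Fin p) ℝ[X]} {k l : ℕ}
    (hf : f.natDegree ≤ k) (hG : ∀ i j, (G i j).natDegree ≤ l) (i j : Fin p) :
    ((f • G) i j).natDegree ≤ k + l := by
  rw [Matrix.smul_apply, smul_eq_mul]
  exact natDegree_mul_le_of_le hf (hG i j)

theorem exists_certificate_even {F : Matrix (Fin p) (Fin p) ℝ[X]} (hsymm : F.IsSymm) {m : ℕ}
    (hdeg : ∀ i j, (F i j).natDegree ≤ 2 * m) {a b c : ℝ} (hab : a < b) (hbc : b < c)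
    (hF : PsdOn F ({a} ∪ Set.Icc b c)) :
    ∃ G₀ G₁ G₂ : Matrix (Fin p) (Fin p) ℝ[X],
      IsSumTwoSymmSquares G₀ ∧ IsSumTwoSymmSquares G₁ ∧ IsSumTwoSymmSquares G₂ ∧
      F = G₀ + ((X - C a) * (X - C b)) • G₁ + ((X - C a) * (C c - X)) • G₂ ∧
      (∀ i j, (G₀ i j).natDegree ≤ 2 * m) ∧
      (∀ i j, ((((X - C a) * (X - C b)) • G₁) i j).natDegree ≤ 2 * m) ∧
      (∀ i j, ((((X - C a) * (C c - X)) • G₂) i j).natDegree ≤ 2 * m) := by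
  have hFI : PsdOn F (Set.Icc b c) := fun x hx => hF x (Or.inr hx)
  obtain ⟨S, T, hS, hT, hTd, hFST⟩ := exists_of_posSemidef_Icc_even hsymm hdeg hbc hFI
  rcases m with _ | m
  · -- For a constant `F` the quotient by `x - a` below would have negative degree.
    have hT0 : T = 0 := by
      ext1 i j
      simpa using hTd i j
    refine ⟨F, 0, 0, ?_, ⟨0, 0, by simp⟩, ⟨0, 0, by simp⟩, by simp, hdeg, by simp, by simp⟩
    rw [hFST, hT0, smul_zero, add_zero]
    exact hS.isSumTwoSymmSquares
  -- At `a` the weight `(x - b) (c - x)` is negative, so `F(a) ≤ S(a)`.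
  obtain ⟨G, hG, hGa, hGS⟩ := hS.exists_le_of_eval_le (hF a (Or.inl rfl)) (a := a) (by
    have h1 : eval a S - eval a F = ((b - a) * (c - a)) • eval a T := by
      nth_rewrite 1 [hFST]
      rw [eval_add, eval_smul, sub_add_cancel_left, ← neg_smul]
      congr 1
      simp only [eval_mul, Polynomial.eval_sub, eval_X, eval_C]
      ring
    rw [h1]
    exact (hT.posSemidef a).smul (mul_nonneg (by linarith) (by linarith)))
  obtain ⟨P, hPs, hPd, hP, hFP⟩ := exists_eq_X_sub_C_smul (E := F - G) (n := 2 * m + 1)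
    (hsymm.sub hG.isSumTwoSymmSquares.isSymm)
    (fun i j => (natDegree_sub_le _ _).trans (max_le (hdeg i j) (hG.natDegree_le i j))) hab
    (by rw [eval_sub, hGa, sub_self]) (c := c) (fun x hx => by
      have h1 : eval x (F - G) = (eval x S - eval x G) + ((x - b) * (c - x)) • eval x T := by
        rw [eval_sub, hFST, eval_add, eval_smul]
        simp only [eval_mul, Polynomial.eval_sub, eval_X, eval_C]
        abel
      rw [h1]
      exact (hGS x).add ((hT.posSemidef x).smul
        (mul_nonneg (sub_nonneg.mpr hx.1) (sub_nonneg.mpr hx.2))))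
  obtain ⟨U, V, hU, hV, hPUV⟩ := exists_of_posSemidef_Icc_odd hPs hPd hbc hP
  refine ⟨G, V, U, hG.isSumTwoSymmSquares, hV.isSumTwoSymmSquares, hU.isSumTwoSymmSquares, ?_,
    hG.natDegree_le, fun i j => ?_, fun i j => ?_⟩
  · rw [sub_eq_iff_eq_add.mp hFP, hPUV, smul_add, smul_smul, smul_smul]
    abel
  · exact (natDegree_smul_le (k := 2) (by compute_degree) hV.natDegree_le i j).trans (by omega)
  · exact (natDegree_smul_le (k := 2) (by compute_degree) hU.natDegree_le i j).trans (by omega)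

theorem exists_certificate_odd {F : Matrix (Fin p) (Fin p) ℝ[X]} (hsymm : F.IsSymm) {m : ℕ}
    (hdeg : ∀ i j, (F i j).natDegree ≤ 2 * m + 1) {a b c : ℝ} (hab : a < b) (hbc : b < c)
    (hF : PsdOn F ({a} ∪ Set.Icc b c)) :
    ∃ G₀ G₁ G₃ : Matrix (Fin p) (Fin p) ℝ[X],
      IsSumTwoSymmSquares G₀ ∧ IsSumTwoSymmSquares G₁ ∧ IsSumTwoSymmSquares G₃ ∧
      F = (X - C a) • G₀ + (C c - X) • G₁ + ((X - C a) * (X - C b) * (C c - X)) • G₃ ∧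
      (∀ i j, (((X - C a : ℝ[X]) • G₀) i j).natDegree ≤ 2 * m + 1) ∧
      (∀ i j, (((C c - X : ℝ[X]) • G₁) i j).natDegree ≤ 2 * m + 1) ∧
      (∀ i j, ((((X - C a) * (X - C b) * (C c - X)) • G₃) i j).natDegree ≤ 2 * m + 1) := by
  have hFI : PsdOn F (Set.Icc b c) := fun x hx => hF x (Or.inr hx)
  have hca : 0 < c - a := by linarith
  obtain ⟨S, T, hS, hT, hFST⟩ := exists_of_posSemidef_Icc_odd hsymm hdeg hbc hFI
  -- At `a` the weight `x - b` is negative, so `F(a) ≤ (c - a) S(a)`.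
  obtain ⟨G, hG, hGa, hGS⟩ := hS.exists_le_of_eval_le (N := (c - a)⁻¹ • eval a F)
    ((hF a (Or.inl rfl)).smul (inv_nonneg.mpr hca.le)) (a := a) (by
    have h1 : eval a S - (c - a)⁻¹ • eval a F = ((c - a)⁻¹ * (b - a)) • eval a T := by
      rw [hFST, eval_add, eval_smul, eval_smul, smul_add, smul_smul, smul_smul]
      simp only [Polynomial.eval_sub, eval_X, eval_C]
      rw [inv_mul_cancel₀ hca.ne', one_smul, sub_add_cancel_left, ← neg_smul]
      congr 1
      ring
    rw [h1]
    exact (hT.isSumTwoSymmSquares.posSemidef a).smul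
      (mul_nonneg (inv_nonneg.mpr hca.le) (by linarith)))
  have hdG : ∀ i j, (((C c - X : ℝ[X]) • G) i j).natDegree ≤ 2 * m + 1 := fun i j =>
    (natDegree_smul_le (k := 1) (by compute_degree) hG.natDegree_le i j).trans (by omega)
  obtain ⟨P, hPs, hPd, hP, hFP⟩ := exists_eq_X_sub_C_smul (E := F - (C c - X : ℝ[X]) • G)
    (n := 2 * m) (hsymm.sub (hG.isSumTwoSymmSquares.isSymm.smul _))
    (fun i j => (natDegree_sub_le _ _).trans (max_le (hdeg i j) (hdG i j))) hab
    (by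
      rw [eval_sub, eval_smul, hGa, smul_smul]
      simp only [Polynomial.eval_sub, eval_X, eval_C]
      rw [mul_inv_cancel₀ hca.ne', one_smul, sub_self])
    (c := c) (fun x hx => by
      have h1 : eval x (F - (C c - X : ℝ[X]) • G)
          = (c - x) • (eval x S - eval x G) + (x - b) • eval x T := by
        rw [eval_sub, hFST, eval_add, eval_smul, eval_smul, eval_smul, smul_sub]
        simp only [Polynomial.eval_sub, eval_X, eval_C]
        abel
      rw [h1]
      exact ((hGS x).smul (sub_nonneg.mpr hx.2)).add
        ((hT.isSumTwoSymmSquares.posSemidef x).smul (sub_nonneg.mpr hx.1)))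
  obtain ⟨U, V, hU, hV, hVd, hPUV⟩ := exists_of_posSemidef_Icc_even hPs hPd hbc hP
  refine ⟨U, G, V, hU.isSumTwoSymmSquares, hG.isSumTwoSymmSquares, hV, ?_, fun i j => ?_, hdG,
    fun i j => ?_⟩
  · rw [sub_eq_iff_eq_add.mp hFP, hPUV, smul_add, smul_smul, ← mul_assoc]
    abel
  · exact (natDegree_smul_le (k := 1) (by compute_degree) hU.natDegree_le i j).trans (by omega)
  · rw [Matrix.smul_apply, smul_eq_mul]
    rcases hVd i j with h | h
    · simp [h]
    · refine (natDegree_mul_le_of_le (m := 3) ?_ le_rfl).trans (by omega)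
      compute_degree

end MatPoly

theorem mainTheorem1 (p n : ℕ) (a b c : ℝ) (hab : a < b) (hbc : b < c)
    (F : Matrix (Fin p) (Fin p) ℝ[X]) (hsymm : F.IsSymm)
    (hdeg : MatPoly.degree F = (n : WithBot ℕ))
    (hpsd : MatPoly.PsdOn F ({a} ∪ Set.Icc b c)) :
    (Even n → ∃ G₀ G₁ G₂ : Matrix (Fin p) (Fin p) ℝ[X],
      MatPoly.IsSumTwoSymmSquares G₀ ∧ MatPoly.IsSumTwoSymmSquares G₁ ∧
      MatPoly.IsSumTwoSymmSquares G₂ ∧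
      F = G₀ + ((X - C a) * (X - C b)) • G₁ + ((X - C a) * (C c - X)) • G₂ ∧
      MatPoly.degree G₀ ≤ (n : WithBot ℕ) ∧
      MatPoly.degree (((X - C a) * (X - C b)) • G₁) ≤ (n : WithBot ℕ) ∧
      MatPoly.degree (((X - C a) * (C c - X)) • G₂) ≤ (n : WithBot ℕ)) ∧
    (Odd n → ∃ G₀ G₁ G₂ G₃ : Matrix (Fin p) (Fin p) ℝ[X],
      MatPoly.IsSumTwoSymmSquares G₀ ∧ MatPoly.IsSumTwoSymmSquares G₁ ∧
      MatPoly.IsSumTwoSymmSquares G₂ ∧ MatPoly.IsSumTwoSymmSquares G₃ ∧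
      F = (X - C a) • G₀ + (C c - X) • G₁ + ((X - C a) ^ 2 * (X - C b)) • G₂ +
        ((X - C a) * (X - C b) * (C c - X)) • G₃ ∧
      MatPoly.degree ((X - C a) • G₀) ≤ (n : WithBot ℕ) ∧
      MatPoly.degree ((C c - X) • G₁) ≤ (n : WithBot ℕ) ∧
      MatPoly.degree (((X - C a) ^ 2 * (X - C b)) • G₂) ≤ (n : WithBot ℕ) ∧
      MatPoly.degree (((X - C a) * (X - C b) * (C c - X)) • G₃) ≤ (n : WithBot ℕ)) := by
  have hle := MatPoly.degree_le_iff.mp hdeg.le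
  simp only [MatPoly.degree_le_iff]
  constructor
  · intro hn
    obtain ⟨m, rfl⟩ := hn.two_dvd
    exact MatPoly.exists_certificate_even hsymm hle hab hbc hpsd
  · rintro ⟨m, rfl⟩
    obtain ⟨G₀, G₁, G₃, h₀, h₁, h₃, h, d₀, d₁, d₃⟩ :=
      MatPoly.exists_certificate_odd hsymm hle hab hbc hpsd
    -- The weight `(x - a)² (x - b)` is dispensable: its coefficient can be taken to be zero.
    exact ⟨G₀, G₁, 0, G₃, h₀, h₁, ⟨0, 0, by simp⟩, h₃, by simpa using h, d₀, d₁, by simp, d₃⟩
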